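/- **Theorem (Reconstruction for linear operads).** Let $K$ be an infinite field and let $P$ be a symmetric operad in $K$-vector spaces, with operations $P(n)$ in every arity $n\ge 0$ and with a unit in $P(1)$. Let $U_P:\mathrm{Alg}_P\to \mathrm{Vect}_K$ be the forgetful functor from the category of $P$-algebras to the category of $K$-vector spaces. Let $\mathrm{End}(U_P)$ be its endomorphism operad: in arity $n$ it is the $K$-vector space $$\mathrm{End}(U_P)(n)=\mathrm{Nat}(U_P^{\otimes n},U_P)=\int_{A\in \mathrm{Alg}_P}\mathrm{Hom}_K\bigl(U_P(A)^{\otimes n},U_P(A)\bigr)$$ of natural transformations from $U_P^{\otimes n}$ to $U_P$; the unit is the identity transformation, operadic composition is $(\varphi;\psi_1,\dots,\psi_k)\mapsto\varphi\circ(\psi_1\otimes\cdots\otimes\psi_k)$, and symmetric groups act by permuting the inputs. Then the unit morphism $$P\longrightarrow \mathrm{End}(U_P),$$ which sends $p\in P(n)$ to the natural transformation whose component at a $P$-algebra $A$ is the structure map $A^{\otimes n}\to A$ given by $p$, is an isomorphism of operads. -/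

import Mathlib

open CategoryTheory
open scoped TensorProduct

universe u v v' w

noncomputable section

namespace LinOperad

/-! ### Relabelling bijections

`finSigmaFinEquiv : (Σ i, Fin (n i)) ≃ Fin (∑ i, n i)` lists the elements of the blocks
`Fin (n 0), Fin (n 1), …` one after another. -/

/-- The block permutation: `σ : Fin l ≃ Fin k` moves the `i`-th block of length `n (σ i)` to the
`σ i`-th place. -/
def blockPerm {l k : ℕ} (σ : Fin l ≃ Fin k) (n : Fin k → ℕ) :
    Fin (∑ i, n (σ i)) ≃ Fin (∑ j, n j) :=
  finSigmaFinEquiv.symm.trans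
    ((Equiv.sigmaCongrLeft (β := fun j => Fin (n j)) σ).trans finSigmaFinEquiv)

/-- The direct sum of bijections `τ i : Fin (n i) ≃ Fin (n' i)`. -/
def blockSum {k : ℕ} {n n' : Fin k → ℕ} (τ : ∀ i, Fin (n i) ≃ Fin (n' i)) :
    Fin (∑ i, n i) ≃ Fin (∑ i, n' i) :=
  finSigmaFinEquiv.symm.trans ((Equiv.sigmaCongrRight τ).trans finSigmaFinEquiv)

/-- The canonical (order preserving) bijection expressing `n = ∑ i : Fin 1, n`. -/
def sumOne (n : ℕ) : Fin n ≃ Fin (∑ _i : Fin 1, n) :=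
  (Equiv.uniqueSigma (fun _ : Fin 1 => Fin n)).symm.trans finSigmaFinEquiv

/-- The canonical (order preserving) bijection expressing `n = ∑ i : Fin n, 1`. -/
def sumOnes (n : ℕ) : Fin n ≃ Fin (∑ _i : Fin n, 1) :=
  (Equiv.sigmaUnique (Fin n) (fun _ => Fin 1)).symm.trans finSigmaFinEquiv

/-- A doubly indexed family of arities `m i j` (`i < k`, `j < n i`), as a family indexed by
`Fin (∑ i, n i)`. -/
def flatten {k : ℕ} {n : Fin k → ℕ} {S : Sort*} (m : ∀ i, Fin (n i) → S) :
    Fin (∑ i, n i) → S :=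
  fun a => m (finSigmaFinEquiv.symm a).1 (finSigmaFinEquiv.symm a).2

/-- The bijection `(i, (j, l)) ↦ ((i, j), l)` with the pairs `(i, j)` enumerated in order. -/
def sigmaAssoc {k : ℕ} {n : Fin k → ℕ} (m : ∀ i, Fin (n i) → ℕ) :
    ((i : Fin k) × Fin (∑ j, m i j)) ≃ ((a : Fin (∑ i, n i)) × Fin (flatten m a)) :=
  (Equiv.sigmaCongrRight fun _ => finSigmaFinEquiv.symm).trans
    ((Equiv.sigmaAssoc (fun i j => Fin (m i j))).symm.trans
      (Equiv.sigmaCongrLeft' (β := fun s : (i : Fin k) × Fin (n i) => Fin (m s.1 s.2))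
        finSigmaFinEquiv))

/-- The canonical (order preserving) bijection expressing
`∑ i, ∑ j, m i j = ∑ a, (flatten m) a`. -/
def sumAssoc {k : ℕ} {n : Fin k → ℕ} (m : ∀ i, Fin (n i) → ℕ) :
    Fin (∑ i, ∑ j, m i j) ≃ Fin (∑ a, flatten m a) :=
  finSigmaFinEquiv.symm.trans ((sigmaAssoc m).trans finSigmaFinEquiv)

end LinOperad

open LinOperad

/-- A (symmetric, unital) operad in vector spaces over `K`, in terms of the total compositions
`γ : P(k) ⊗ P(n₁) ⊗ ⋯ ⊗ P(n_k) → P(n₁ + ⋯ + n_k)`.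

The underlying symmetric sequence is a functor from the groupoid of the finite sets `Fin n` and
bijections to vector spaces: since a bijection `Fin m ≃ Fin n` exists only for `m = n`, this is
the same as an action of the symmetric group on each `P(n)`.  It is written as a left action; the
usual right action is `p · σ = relabel σ⁻¹ p`.  Relabelling along the order preserving bijections
`Fin m ≃ Fin n` for (propositionally) equal `m` and `n` is the transport along `m = n`. -/
structure LinOperad (K : Type u) [Field K] where
  /-- The space of `n`-ary operations. -/
  obj : ℕ → Type v
  [addCommGroup : ∀ n, AddCommGroup (obj n)]
  [module : ∀ n, Module K (obj n)]
  /-- The symmetric structure. -/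
  relabel : ∀ {m n : ℕ}, (Fin m ≃ Fin n) → obj m →ₗ[K] obj n
  /-- The operadic unit. -/
  one : obj 1
  /-- The operadic composition. -/
  comp : ∀ {k : ℕ} (n : Fin k → ℕ),
    obj k →ₗ[K] MultilinearMap K (fun i => obj (n i)) (obj (∑ i, n i))
  relabel_refl : ∀ {n : ℕ} (p : obj n), relabel (Equiv.refl (Fin n)) p = p
  relabel_trans : ∀ {l m n : ℕ} (σ : Fin l ≃ Fin m) (τ : Fin m ≃ Fin n) (p : obj l),
    relabel (σ.trans τ) p = relabel τ (relabel σ p)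
  one_comp : ∀ {n : ℕ} (p : obj n),
    comp (fun _ : Fin 1 => n) one (fun _ => p) = relabel (sumOne n) p
  comp_one : ∀ {n : ℕ} (p : obj n),
    comp (fun _ : Fin n => 1) p (fun _ => one) = relabel (sumOnes n) p
  comp_assoc : ∀ {k : ℕ} {n : Fin k → ℕ} {m : ∀ i, Fin (n i) → ℕ}
    (r : obj k) (q : ∀ i, obj (n i)) (p : ∀ i j, obj (m i j)),
    relabel (sumAssoc m)
        (comp (fun i => ∑ j, m i j) r (fun i => comp (m i) (q i) (p i))) =
      comp (flatten m) (comp n r q)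
        (fun a => p (finSigmaFinEquiv.symm a).1 (finSigmaFinEquiv.symm a).2)
  relabel_comp : ∀ {l k : ℕ} (σ : Fin l ≃ Fin k) {n : Fin k → ℕ}
    (r : obj l) (q : ∀ j, obj (n j)),
    comp n (relabel σ r) q =
      relabel (blockPerm σ n) (comp (fun i => n (σ i)) r (fun i => q (σ i)))
  comp_relabel : ∀ {k : ℕ} {n n' : Fin k → ℕ} (τ : ∀ i, Fin (n i) ≃ Fin (n' i))
    (r : obj k) (q : ∀ i, obj (n i)),
    comp n' r (fun i => relabel (τ i) (q i)) = relabel (blockSum τ) (comp n r q)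

namespace LinOperad

attribute [instance] LinOperad.addCommGroup LinOperad.module

variable {K : Type u} [Field K]

/-- Morphisms of operads. -/
structure Hom (P : LinOperad.{u, v} K) (Q : LinOperad.{u, v'} K) where
  /-- The component in arity `n`. -/
  app : ∀ n, P.obj n →ₗ[K] Q.obj n
  app_relabel : ∀ {m n : ℕ} (σ : Fin m ≃ Fin n) (p : P.obj m),
    app n (P.relabel σ p) = Q.relabel σ (app m p)
  app_one : app 1 P.one = Q.one
  app_comp : ∀ {k : ℕ} (n : Fin k → ℕ) (r : P.obj k) (q : ∀ i, P.obj (n i)),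
    app _ (P.comp n r q) = Q.comp n (app k r) (fun i => app (n i) (q i))

/-- A morphism of operads is an isomorphism if it has a two-sided inverse morphism of operads. -/
def Hom.IsIso {P : LinOperad.{u, v} K} {Q : LinOperad.{u, v'} K} (f : Hom P Q) : Prop :=
  ∃ g : Hom Q P, (∀ n p, g.app n (f.app n p) = p) ∧ (∀ n q, f.app n (g.app n q) = q)

/-! ### Algebras over an operad -/

/-- An algebra over the operad `P`: a vector space `A` with structure maps
`P(n) → Hom(A^{⊗ n}, A)` compatible with symmetries, unit and composition. -/
structure Alg (P : LinOperad.{u, v} K) where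
  /-- The underlying vector space. -/
  carrier : ModuleCat.{w} K
  /-- The action of operations. -/
  act : ∀ n, P.obj n →ₗ[K] (⨂[K] _i : Fin n, carrier) →ₗ[K] carrier
  act_relabel : ∀ {m n : ℕ} (σ : Fin m ≃ Fin n) (p : P.obj m) (x : Fin n → carrier),
    act n (P.relabel σ p) (PiTensorProduct.tprod K x) =
      act m p (PiTensorProduct.tprod K fun i => x (σ i))
  act_one : ∀ x : Fin 1 → carrier, act 1 P.one (PiTensorProduct.tprod K x) = x 0
  act_comp : ∀ {k : ℕ} (n : Fin k → ℕ) (r : P.obj k) (q : ∀ i, P.obj (n i))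
    (x : Fin (∑ i, n i) → carrier),
    act _ (P.comp n r q) (PiTensorProduct.tprod K x) =
      act k r (PiTensorProduct.tprod K fun i =>
        act (n i) (q i) (PiTensorProduct.tprod K fun j => x (finSigmaFinEquiv ⟨i, j⟩)))

namespace Alg

variable {P : LinOperad.{u, v} K}

/-- Morphisms of `P`-algebras: linear maps `f` with `f ∘ act p = act p ∘ f^{⊗ n}` for all
`p ∈ P(n)`. -/
@[ext]
structure Hom (A B : Alg.{u, v, w} P) where
  /-- The underlying linear map. -/
  hom : A.carrier ⟶ B.carrier
  hom_act : ∀ (n : ℕ) (p : P.obj n) (t : ⨂[K] _i : Fin n, A.carrier),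
    hom.hom (A.act n p t) = B.act n p (PiTensorProduct.map (fun _ => hom.hom) t)

/-- The category of `P`-algebras. -/
instance : Category (Alg.{u, v, w} P) where
  Hom A B := Hom A B
  id A := ⟨𝟙 A.carrier, fun n p t => by simp [PiTensorProduct.map_id]⟩
  comp f g := ⟨f.hom ≫ g.hom, fun n p t => by
    simp [f.hom_act, g.hom_act, PiTensorProduct.map_comp]⟩

variable (P) in
/-- The forgetful functor `U_P` from `P`-algebras to vector spaces. -/
def forget : Alg.{u, v, w} P ⥤ ModuleCat.{w} K where
  obj A := A.carrier
  map f := f.hom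

end Alg

/-! ### The endomorphism operad of a functor -/

section EndOperad

/-- Composition of multilinear operations on one vector space `V`:
`(f; g₁, …, g_k) ↦ f ∘ (g₁ ⊗ ⋯ ⊗ g_k)`. -/
def opComp {V : Type w} [AddCommGroup V] [Module K V] {k : ℕ} {n : Fin k → ℕ}
    (f : (⨂[K] _i : Fin k, V) →ₗ[K] V) (g : ∀ i, (⨂[K] _j : Fin (n i), V) →ₗ[K] V) :
    (⨂[K] _i : Fin (∑ i, n i), V) →ₗ[K] V :=
  PiTensorProduct.lift
    (MultilinearMap.domDomCongr finSigmaFinEquiv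
      ((f.compMultilinearMap (PiTensorProduct.tprod K)).compMultilinearMap
        fun i => (g i).compMultilinearMap (PiTensorProduct.tprod K)))

theorem opComp_tprod {V : Type w} [AddCommGroup V] [Module K V] {k : ℕ} {n : Fin k → ℕ}
    (f : (⨂[K] _i : Fin k, V) →ₗ[K] V) (g : ∀ i, (⨂[K] _j : Fin (n i), V) →ₗ[K] V)
    (x : Fin (∑ i, n i) → V) :
    opComp f g (PiTensorProduct.tprod K x) =
      f (PiTensorProduct.tprod K fun i =>
        g i (PiTensorProduct.tprod K fun j => x (finSigmaFinEquiv ⟨i, j⟩))) := by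
  simp only [opComp, PiTensorProduct.lift.tprod]
  rfl

/-- Relabelling of the inputs of a multilinear operation along `σ : Fin m ≃ Fin n`:
`(x₁, …, x_n) ↦ f (x_{σ 1}, …, x_{σ m})`. -/
def opRelabel {V : Type w} [AddCommGroup V] [Module K V] {m n : ℕ} (σ : Fin m ≃ Fin n)
    (f : (⨂[K] _i : Fin m, V) →ₗ[K] V) : (⨂[K] _i : Fin n, V) →ₗ[K] V :=
  f ∘ₗ (PiTensorProduct.reindex K (fun _ : Fin n => V) σ.symm).toLinearMap

theorem opRelabel_tprod {V : Type w} [AddCommGroup V] [Module K V] {m n : ℕ} (σ : Fin m ≃ Fin n)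
    (f : (⨂[K] _i : Fin m, V) →ₗ[K] V) (x : Fin n → V) :
    opRelabel σ f (PiTensorProduct.tprod K x) = f (PiTensorProduct.tprod K fun i => x (σ i)) := by
  simp [opRelabel, PiTensorProduct.reindex_tprod]

universe uD vD

variable {D : Type uD} [Category.{vD} D] (F : D ⥤ ModuleCat.{w} K)

/-- The vector space `Nat(F^{⊗ n}, F) = ∫_{X ∈ D} Hom(F(X)^{⊗ n}, F(X))` of natural
transformations from `F^{⊗ n}` to `F`, as a subspace of the product over all `X`. -/
def natTrans (n : ℕ) : Submodule K (∀ X : D, (⨂[K] _i : Fin n, F.obj X) →ₗ[K] F.obj X) where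
  carrier := {φ | ∀ ⦃X Y : D⦄ (f : X ⟶ Y),
    φ Y ∘ₗ PiTensorProduct.map (fun _ => (F.map f).hom) = (F.map f).hom ∘ₗ φ X}
  zero_mem' := fun X Y f => by simp
  add_mem' := fun {φ ψ} hφ hψ X Y f => by
    simp [LinearMap.add_comp, LinearMap.comp_add, hφ f, hψ f]
  smul_mem' := fun c φ hφ X Y f => by
    simp [LinearMap.smul_comp, LinearMap.comp_smul, hφ f]

variable {F}

theorem natTrans_tprod {n : ℕ} (φ : natTrans F n) {X Y : D} (f : X ⟶ Y) (x : Fin n → F.obj X) :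
    φ.1 Y (PiTensorProduct.tprod K fun i => (F.map f).hom (x i)) =
      (F.map f).hom (φ.1 X (PiTensorProduct.tprod K x)) := by
  have h := LinearMap.congr_fun (φ.2 f) (PiTensorProduct.tprod K x)
  simpa [PiTensorProduct.map_tprod] using h

theorem natTrans_ext {n : ℕ} {φ ψ : natTrans F n}
    (h : ∀ X (x : Fin n → F.obj X), φ.1 X (PiTensorProduct.tprod K x) =
      ψ.1 X (PiTensorProduct.tprod K x)) : φ = ψ := by
  apply Subtype.ext
  funext X
  apply PiTensorProduct.ext
  ext x
  exact h X x

theorem mem_natTrans {n : ℕ} {φ : ∀ X : D, (⨂[K] _i : Fin n, F.obj X) →ₗ[K] F.obj X}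
    (h : ∀ ⦃X Y : D⦄ (f : X ⟶ Y) (x : Fin n → F.obj X),
      φ Y (PiTensorProduct.tprod K fun i => (F.map f).hom (x i)) =
        (F.map f).hom (φ X (PiTensorProduct.tprod K x))) : φ ∈ natTrans F n := by
  intro X Y f
  apply PiTensorProduct.ext
  ext x
  simpa [PiTensorProduct.map_tprod] using h f x

/-- Relabelling of inputs on natural transformations. -/
def natRelabel {m n : ℕ} (σ : Fin m ≃ Fin n) : natTrans F m →ₗ[K] natTrans F n where
  toFun φ := ⟨fun X => opRelabel σ (φ.1 X), mem_natTrans fun X Y f x => by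
    simp only [opRelabel_tprod]
    exact natTrans_tprod φ f (fun i => x (σ i))⟩
  map_add' φ ψ := natTrans_ext fun X x => by
    simp only [opRelabel_tprod, Submodule.coe_add, Pi.add_apply, LinearMap.add_apply]
  map_smul' c φ := natTrans_ext fun X x => by
    simp only [opRelabel_tprod, Submodule.coe_smul, Pi.smul_apply, LinearMap.smul_apply,
      RingHom.id_apply]

theorem natRelabel_tprod {m n : ℕ} (σ : Fin m ≃ Fin n) (φ : natTrans F m) (X : D)
    (x : Fin n → F.obj X) :
    (natRelabel σ φ).1 X (PiTensorProduct.tprod K x) =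
      φ.1 X (PiTensorProduct.tprod K fun i => x (σ i)) :=
  opRelabel_tprod σ _ x

variable (F) in
/-- The identity natural transformation `F^{⊗ 1} = F → F`. -/
def natOne : natTrans F 1 :=
  ⟨fun _ => (PiTensorProduct.subsingletonEquiv (0 : Fin 1)).toLinearMap,
    mem_natTrans fun _ _ f _ =>
      (PiTensorProduct.subsingletonEquiv_apply_tprod _ _).trans
        (congrArg (F.map f).hom (PiTensorProduct.subsingletonEquiv_apply_tprod _ _).symm)⟩

theorem natOne_tprod (X : D) (x : Fin 1 → F.obj X) :
    (natOne F).1 X (PiTensorProduct.tprod K x) = x 0 :=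
  PiTensorProduct.subsingletonEquiv_apply_tprod _ _

/-- The composite natural transformation `φ ∘ (ψ₁ ⊗ ⋯ ⊗ ψ_k)`. -/
def natCompFun {k : ℕ} {n : Fin k → ℕ} (φ : natTrans F k) (ψ : ∀ i, natTrans F (n i)) :
    natTrans F (∑ i, n i) :=
  ⟨fun X => opComp (φ.1 X) (fun i => (ψ i).1 X), mem_natTrans fun X Y f x => by
    simp only [opComp_tprod]
    rw [← natTrans_tprod φ f]
    congr 2
    funext i
    exact natTrans_tprod (ψ i) f (fun j => x (finSigmaFinEquiv ⟨i, j⟩))⟩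

theorem natCompFun_tprod {k : ℕ} {n : Fin k → ℕ} (φ : natTrans F k)
    (ψ : ∀ i, natTrans F (n i)) (X : D) (x : Fin (∑ i, n i) → F.obj X) :
    (natCompFun φ ψ).1 X (PiTensorProduct.tprod K x) =
      φ.1 X (PiTensorProduct.tprod K fun i =>
        (ψ i).1 X (PiTensorProduct.tprod K fun j => x (finSigmaFinEquiv ⟨i, j⟩))) :=
  opComp_tprod _ _ x

theorem natEval_update {k : ℕ} {n : Fin k → ℕ} [DecidableEq (Fin k)]
    (ψ : ∀ i, natTrans F (n i)) (i : Fin k) (a : natTrans F (n i))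
    (X : D) (y : ∀ i, Fin (n i) → F.obj X) :
    (fun j => (Function.update ψ i a j).1 X (PiTensorProduct.tprod K (y j))) =
      Function.update (fun j => (ψ j).1 X (PiTensorProduct.tprod K (y j))) i
        (a.1 X (PiTensorProduct.tprod K (y i))) := by
  funext j
  exact Function.apply_update
    (fun j (b : natTrans F (n j)) => b.1 X (PiTensorProduct.tprod K (y j))) ψ i a j

/-- Composition of natural transformations, as a multilinear map. -/
def natComp {k : ℕ} (n : Fin k → ℕ) :
    natTrans F k →ₗ[K]
      MultilinearMap K (fun i => natTrans F (n i)) (natTrans F (∑ i, n i)) where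
  toFun φ :=
    { toFun := natCompFun φ
      map_update_add' := fun ψ i a b => natTrans_ext fun X x => by
        simp only [natCompFun_tprod, Submodule.coe_add, Pi.add_apply, LinearMap.add_apply]
        rw [natEval_update ψ i (a + b) X (fun i j => x (finSigmaFinEquiv ⟨i, j⟩)),
          natEval_update ψ i a X (fun i j => x (finSigmaFinEquiv ⟨i, j⟩)),
          natEval_update ψ i b X (fun i j => x (finSigmaFinEquiv ⟨i, j⟩))]
        simp only [Submodule.coe_add, Pi.add_apply, LinearMap.add_apply,
          MultilinearMap.map_update_add, map_add]
      map_update_smul' := fun ψ i c a => natTrans_ext fun X x => by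
        simp only [natCompFun_tprod, Submodule.coe_smul, Pi.smul_apply, LinearMap.smul_apply]
        rw [natEval_update ψ i (c • a) X (fun i j => x (finSigmaFinEquiv ⟨i, j⟩)),
          natEval_update ψ i a X (fun i j => x (finSigmaFinEquiv ⟨i, j⟩))]
        simp only [Submodule.coe_smul, Pi.smul_apply, LinearMap.smul_apply,
          MultilinearMap.map_update_smul, map_smul] }
  map_add' φ ψ := by
    ext1 q
    exact natTrans_ext fun X x => by
      simp only [MultilinearMap.coe_mk, add_apply, natCompFun_tprod,
        Submodule.coe_add, Pi.add_apply, LinearMap.add_apply]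
  map_smul' c φ := by
    ext1 q
    exact natTrans_ext fun X x => by
      simp only [MultilinearMap.coe_mk, smul_apply, natCompFun_tprod,
        Submodule.coe_smul, Pi.smul_apply, LinearMap.smul_apply, RingHom.id_apply]

theorem natComp_tprod {k : ℕ} (n : Fin k → ℕ) (φ : natTrans F k)
    (ψ : ∀ i, natTrans F (n i)) (X : D) (x : Fin (∑ i, n i) → F.obj X) :
    (natComp n φ ψ).1 X (PiTensorProduct.tprod K x) =
      φ.1 X (PiTensorProduct.tprod K fun i =>
        (ψ i).1 X (PiTensorProduct.tprod K fun j => x (finSigmaFinEquiv ⟨i, j⟩))) :=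
  opComp_tprod _ _ x

theorem sumAssoc_apply {k : ℕ} {n : Fin k → ℕ} (m : ∀ i, Fin (n i) → ℕ) (a : Fin (∑ i, n i))
    (l : Fin (flatten m a)) :
    sumAssoc m (finSigmaFinEquiv ⟨(finSigmaFinEquiv.symm a).1,
        finSigmaFinEquiv ⟨(finSigmaFinEquiv.symm a).2, l⟩⟩) =
      finSigmaFinEquiv ⟨a, l⟩ := by
  simp only [sumAssoc, Equiv.trans_apply, Equiv.symm_apply_apply]
  congr 1
  rw [← Equiv.eq_symm_apply]
  rfl

variable (F)

/-- The endomorphism operad `End(F)` of a functor `F : D ⥤ Vect_K`, with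
`End(F)(n) = Nat(F^{⊗ n}, F)` and the structure given by composition of multilinear operations. -/
def endOperad : LinOperad.{u, max u uD w} K where
  obj n := natTrans F n
  relabel σ := natRelabel σ
  one := natOne F
  comp n := natComp n
  relabel_refl p := natTrans_ext fun X x => natRelabel_tprod _ _ X x
  relabel_trans σ τ p := natTrans_ext fun X x => by
    simp only [natRelabel_tprod, Equiv.trans_apply]
  one_comp p := natTrans_ext fun X x => by
    simp only [natRelabel_tprod, natComp_tprod, natOne_tprod]
    rfl
  comp_one p := natTrans_ext fun X x => by
    simp only [natRelabel_tprod, natComp_tprod, natOne_tprod]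
    rfl
  comp_assoc {k n m} r q p := natTrans_ext fun X x => by
    refine Eq.trans ?_ (natComp_tprod (flatten m) _ (fun a => p _ _) X x).symm
    refine Eq.trans ?_ (natComp_tprod n r q X _).symm
    simp only [natRelabel_tprod, natComp_tprod]
    refine congrArg (fun y => r.1 X (PiTensorProduct.tprod K y)) (funext fun i => ?_)
    refine congrArg (fun y => (q i).1 X (PiTensorProduct.tprod K y)) (funext fun j => ?_)
    let G : ((i : Fin k) × Fin (n i)) → F.obj X := fun s =>
      (p s.1 s.2).1 X (PiTensorProduct.tprod K fun l =>
        x (sumAssoc m (finSigmaFinEquiv ⟨s.1, finSigmaFinEquiv ⟨s.2, l⟩⟩)))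
    have hG : G (finSigmaFinEquiv.symm (finSigmaFinEquiv ⟨i, j⟩)) = G ⟨i, j⟩ :=
      congrArg G (finSigmaFinEquiv.symm_apply_apply ⟨i, j⟩)
    refine hG.symm.trans ?_
    refine congrArg (fun y => (p _ _).1 X (PiTensorProduct.tprod K y)) (funext fun l => ?_)
    exact congrArg x (sumAssoc_apply m _ l)
  relabel_comp σ n r q := natTrans_ext fun X x => by
    simp only [natRelabel_tprod, natComp_tprod]
    simp [blockPerm, Equiv.sigmaCongrLeft]
  comp_relabel τ r q := natTrans_ext fun X x => by
    simp only [natRelabel_tprod, natComp_tprod]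
    simp [blockSum]

end EndOperad

/-- The unit `P → End(U_P)` of the adjunction between `P ↦ U_P` and `F ↦ End(F)`: an operation
`p ∈ P(n)` is sent to the natural transformation whose component at a `P`-algebra `A` is the
action `A^{⊗ n} → A` of `p` on `A`. -/
def unit (P : LinOperad.{u, v} K) : Hom P (endOperad (Alg.forget.{u, v, w} P)) where
  app n :=
    { toFun := fun p => ⟨fun A => A.act n p, fun _ _ f =>
        LinearMap.ext fun t => (f.hom_act n p t).symm⟩
      map_add' := fun p q => Subtype.ext <| funext fun A => (A.act n).map_add p q
      map_smul' := fun c p => Subtype.ext <| funext fun A => (A.act n).map_smul c p }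
  app_relabel σ p := natTrans_ext fun A x =>
    (A.act_relabel σ p x).trans
      (natRelabel_tprod (F := Alg.forget.{u, v, w} P) σ ⟨fun A => A.act _ p, _⟩ A x).symm
  app_one := natTrans_ext fun A x => (A.act_one x).trans (natOne_tprod A x).symm
  app_comp n r q := natTrans_ext fun A x =>
    (A.act_comp n r q x).trans
      (natComp_tprod (F := Alg.forget.{u, v, w} P) n ⟨fun A => A.act _ r, _⟩
        (fun i => ⟨fun A => A.act (n i) (q i), _⟩) A x).symm

end LinOperad

end

/-!
The unit `P → End(U_P)` is shown to be bijective in each arity by means of the free `P`-algebra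
on `n` generators `x₁, …, x_n`.

The free algebra on a set `X` is `⨁ m, (P(m) ⊗ V^{⊗ m})_{S_m}` for the vector space `V` with basis
`X`: the sum of copies of `P(m)` indexed by the words `x : Fin m → X`, modulo the relations that
permute an operation together with its word (`FreeCarrier`, `freeAlg`).  It is spanned by the
elements `mono P x p`, which stand for `p(x₁, …, x_m)`, and it has the universal property
`freeLift`.  Hence a natural transformation `φ : U_P^{⊗ n} → U_P` is determined by the single
element `t = φ(x₁ ⊗ ⋯ ⊗ x_n)`.

The operation `p` can be recovered from `p(x₁, …, x_n)` by the linear map `multilinearPart`, which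
extracts the coefficient of `x₁ ⋯ x_n`.  This gives injectivity (`unit_app_injective`).

For surjectivity, let `c₁, …, c_n` be scalars.  Naturality of `φ` under the endomorphism
`x_i ↦ c_i x_i` and multilinearity of `φ` show that this endomorphism multiplies `t` by
`c₁ ⋯ c_n`.  On the other hand, it multiplies a word by the product of the scalars of its letters.
For each linear functional `f`, applying `f` to the rescaled `t` therefore gives a polynomial
function of `c`, which equals `f(t) c₁ ⋯ c_n`.  As `K` is infinite, this is an identity of
polynomials, and comparing the coefficients of `c₁ ⋯ c_n` shows that `t` equals its multilinear
part, so that `t = p(x₁, …, x_n)` for some `p ∈ P(n)` (`eq_mono_multilinearPart`).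
-/

noncomputable section

namespace LinOperad

open DirectSum PiTensorProduct

variable {K : Type u} [Field K]

/-! ### Morphisms that are bijective in each arity -/

theorem Hom.isIso_of_bijective {P : LinOperad.{u, v} K} {Q : LinOperad.{u, v'} K} (f : Hom P Q)
    (hf : ∀ n, Function.Bijective (f.app n)) : f.IsIso := by
  let e n := LinearEquiv.ofBijective (f.app n) (hf n)
  have he : ∀ n p, (e n).symm (f.app n p) = p := fun n p => (e n).symm_apply_apply p
  have he' : ∀ n q, f.app n ((e n).symm q) = q := fun n q => (e n).apply_symm_apply q
  refine ⟨⟨fun n => (e n).symm.toLinearMap, fun σ q => ?_, ?_, fun n r q => ?_⟩, he, he'⟩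
  · apply (hf _).1
    simp only [LinearEquiv.coe_coe, f.app_relabel, he']
  · apply (hf _).1
    simp only [LinearEquiv.coe_coe, f.app_one, he']
  · apply (hf _).1
    simp only [LinearEquiv.coe_coe, f.app_comp, he']

variable (P : LinOperad.{u, v} K) (X : Type u)

/-! ### The vector space underlying the free algebra -/

/-- The direct sum of one copy of `P(m)` for each word of length `m` in the letters `X`, that is,
`⨁ m, P(m) ⊗ V^{⊗ m}` for the vector space `V` with basis `X`. -/
abbrev WordSum := ⨁ a : (m : ℕ) × (Fin m → X), P.obj a.1

variable {X}

/-- The inclusion of the summand `P(m)` indexed by the word `x`. -/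
abbrev word {m : ℕ} (x : Fin m → X) : P.obj m →ₗ[K] WordSum P X :=
  open Classical in
  DirectSum.lof K ((m : ℕ) × (Fin m → X)) (fun a => P.obj a.1) ⟨m, x⟩

/-- The linear map on the direct sum over all words with given restrictions to the summands. -/
def wordDesc {N : Type*} [AddCommGroup N] [Module K N] (f : ∀ m, (Fin m → X) → P.obj m →ₗ[K] N) :
    WordSum P X →ₗ[K] N :=
  open Classical in
  DirectSum.toModule K _ _ fun a => f a.1 a.2

theorem wordDesc_word {N : Type*} [AddCommGroup N] [Module K N]
    (f : ∀ m, (Fin m → X) → P.obj m →ₗ[K] N) {m : ℕ} (x : Fin m → X) (p : P.obj m) :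
    wordDesc P f (word P x p) = f m x p := by
  classical
  exact DirectSum.toModule_lof K (M := fun a : (m : ℕ) × (Fin m → X) => P.obj a.1) ⟨m, x⟩ p

/-- The simultaneous action of permutations `s m` on the operations of arity `m` and on the words
of length `m`.  All arities are permuted at once so that the result is an endomorphism of the
whole direct sum. -/
def permute (s : ∀ m, Equiv.Perm (Fin m)) : WordSum P X →ₗ[K] WordSum P X :=
  wordDesc P fun m x => word P (x ∘ (s m).symm) ∘ₗ P.relabel (s m)

theorem permute_word (s : ∀ m, Equiv.Perm (Fin m)) {m : ℕ} (x : Fin m → X) (p : P.obj m) :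
    permute P s (word P x p) = word P (x ∘ (s m).symm) (P.relabel (s m) p) :=
  wordDesc_word P _ x p

theorem wordSum_hom_ext {N : Type*} [AddCommGroup N] [Module K N] {f g : WordSum P X →ₗ[K] N}
    (h : ∀ (m : ℕ) (x : Fin m → X) (p : P.obj m), f (word P x p) = g (word P x p)) : f = g := by
  classical
  refine DirectSum.linearMap_ext K fun a => LinearMap.ext fun p => ?_
  convert! h a.1 a.2 p

theorem permute_refl : permute P (X := X) (fun _ => Equiv.refl _) = LinearMap.id :=
  wordSum_hom_ext P fun m x p => by
    rw [permute_word, P.relabel_refl]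
    rfl

variable (X) in
/-- The relations that identify an operation applied to a word with its permutations. -/
def symRel : Submodule K (WordSum P X) :=
  Submodule.span K {y | ∃ s t, y = permute P s t - t}

variable (X) in
/-- The vector space underlying the free `P`-algebra on the set `X`, i.e.
`⨁ m, (P(m) ⊗ V^{⊗ m})_{S_m}` for the vector space `V` with basis `X`. -/
abbrev FreeCarrier := WordSum P X ⧸ symRel P X

/-- The element `p(x₁, …, x_m)` of the free algebra, for an operation `p` and letters `x_i`. -/
def mono {m : ℕ} (x : Fin m → X) : P.obj m →ₗ[K] FreeCarrier P X :=
  (symRel P X).mkQ ∘ₗ word P x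

theorem mkQ_word {m : ℕ} (x : Fin m → X) (p : P.obj m) :
    (symRel P X).mkQ (word P x p) = mono P x p := rfl

theorem mono_relabel {m n : ℕ} (σ : Fin m ≃ Fin n) (x : Fin n → X) (p : P.obj m) :
    mono P x (P.relabel σ p) = mono P (x ∘ σ) p := by
  obtain rfl : m = n := by simpa using Fintype.card_congr σ
  rw [← mkQ_word, ← mkQ_word, ← sub_eq_zero, ← map_sub, Submodule.mkQ_apply,
    Submodule.Quotient.mk_eq_zero]
  refine Submodule.subset_span
    ⟨Function.update (fun _ => Equiv.refl _) m σ, word P (x ∘ σ) p, ?_⟩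
  rw [permute_word, Function.update_self, Function.comp_assoc, Equiv.self_comp_symm,
    Function.comp_id]

/-- A linear map on the direct sum over all words descends to the free algebra when it is
invariant under permutations. -/
def freeDesc {N : Type*} [AddCommGroup N] [Module K N] (f : ∀ m, (Fin m → X) → P.obj m →ₗ[K] N)
    (hf : ∀ (m : ℕ) (σ : Equiv.Perm (Fin m)) (x : Fin m → X) (p : P.obj m),
      f m x (P.relabel σ p) = f m (x ∘ σ) p) : FreeCarrier P X →ₗ[K] N :=
  (symRel P X).liftQ (wordDesc P f) <| by
    rw [symRel, Submodule.span_le]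
    rintro _ ⟨s, t, rfl⟩
    rw [SetLike.mem_coe, LinearMap.mem_ker, map_sub, sub_eq_zero, ← LinearMap.comp_apply]
    refine LinearMap.congr_fun (wordSum_hom_ext P fun m x p => ?_) t
    rw [LinearMap.comp_apply, permute_word, wordDesc_word, wordDesc_word, hf,
      Function.comp_assoc, Equiv.symm_comp_self, Function.comp_id]

theorem freeDesc_mono {N : Type*} [AddCommGroup N] [Module K N]
    (f : ∀ m, (Fin m → X) → P.obj m →ₗ[K] N)
    (hf : ∀ (m : ℕ) (σ : Equiv.Perm (Fin m)) (x : Fin m → X) (p : P.obj m),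
      f m x (P.relabel σ p) = f m (x ∘ σ) p) {m : ℕ} (x : Fin m → X) (p : P.obj m) :
    freeDesc P f hf (mono P x p) = f m x p :=
  wordDesc_word P f x p

theorem freeCarrier_hom_ext {N : Type*} [AddCommGroup N] [Module K N]
    {f g : FreeCarrier P X →ₗ[K] N}
    (h : ∀ (m : ℕ) (x : Fin m → X) (p : P.obj m), f (mono P x p) = g (mono P x p)) : f = g :=
  Submodule.linearMap_qext _ (wordSum_hom_ext P h)

theorem wordSum_multilinear_ext {k : ℕ} {N : Type*} [AddCommGroup N] [Module K N]
    {f g : MultilinearMap K (fun _ : Fin k => WordSum P X) N}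
    (h : ∀ (m : Fin k → ℕ) (x : ∀ i, Fin (m i) → X) (p : ∀ i, P.obj (m i)),
      f (fun i => word P (x i) (p i)) = g (fun i => word P (x i) (p i))) : f = g := by
  classical
  refine MultilinearMap.directSum_ext fun a => MultilinearMap.ext fun p => ?_
  convert! h (fun i => (a i).1) (fun i => (a i).2) p

theorem freeCarrier_multilinear_ext {k : ℕ} {N : Type*} [AddCommGroup N] [Module K N]
    {f g : MultilinearMap K (fun _ : Fin k => FreeCarrier P X) N}
    (h : ∀ (m : Fin k → ℕ) (x : ∀ i, Fin (m i) → X) (p : ∀ i, P.obj (m i)),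
      f (fun i => mono P (x i) (p i)) = g (fun i => mono P (x i) (p i))) : f = g := by
  have hfg : f.compLinearMap (fun _ => (symRel P X).mkQ) =
      g.compLinearMap (fun _ => (symRel P X).mkQ) := wordSum_multilinear_ext P h
  ext y
  choose t ht using fun i => (symRel P X).mkQ_surjective (y i)
  obtain rfl : (fun i => (symRel P X).mkQ (t i)) = y := funext ht
  exact congrArg (fun F : MultilinearMap K _ N => F t) hfg

/-! ### The free algebra -/

/-- Operations act on words by composing the operations and concatenating the words.  The values
are taken modulo permutations. -/
def wordAct (k : ℕ) :
    P.obj k →ₗ[K] MultilinearMap K (fun _ : Fin k => WordSum P X) (FreeCarrier P X) :=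
  (MultilinearMap.fromDirectSumEquiv (κ := fun _ : Fin k => (m : ℕ) × (Fin m → X))
      (M := fun _ a => P.obj a.1)).toLinearMap ∘ₗ
    LinearMap.pi fun a =>
      (mono P (flatten fun i => (a i).2)).compMultilinearMapₗ K ∘ₗ P.comp fun i => (a i).1

theorem wordAct_word {k : ℕ} (r : P.obj k) {m : Fin k → ℕ} (x : ∀ i, Fin (m i) → X)
    (p : ∀ i, P.obj (m i)) :
    wordAct P k r (fun i => word P (x i) (p i)) = mono P (flatten x) (P.comp m r p) := by
  classical
  simp only [wordAct]
  convert! MultilinearMap.fromDirectSumEquiv_lof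
    (κ := fun _ : Fin k => (m : ℕ) × (Fin m → X)) (M := fun _ a => P.obj a.1)
    (fun a => (mono P (flatten fun i => (a i).2)).compMultilinearMap (P.comp (fun i => (a i).1) r))
    (fun i => ⟨m i, x i⟩) p

theorem flatten_finSigmaFinEquiv {k : ℕ} {n : Fin k → ℕ} {S : Type*} (x : ∀ i, Fin (n i) → S)
    (i : Fin k) (j : Fin (n i)) : flatten x (finSigmaFinEquiv ⟨i, j⟩) = x i j :=
  congrArg (fun s : (i : Fin k) × Fin (n i) => x s.1 s.2)
    (finSigmaFinEquiv.symm_apply_apply ⟨i, j⟩)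

theorem flatten_comp_blockSum {k : ℕ} {n n' : Fin k → ℕ} (τ : ∀ i, Fin (n i) ≃ Fin (n' i))
    (x : ∀ i, Fin (n' i) → X) : flatten x ∘ blockSum τ = flatten fun i => x i ∘ τ i := by
  funext a
  simp only [flatten, blockSum, Function.comp_apply, Equiv.trans_apply]
  rw [Equiv.symm_apply_apply]
  rfl

/-- The arguments may be permuted by different permutations, so that a single argument can be
permuted while the others are kept. -/
theorem wordAct_permute {k : ℕ} (r : P.obj k) (s : Fin k → ∀ m, Equiv.Perm (Fin m))
    (t : Fin k → WordSum P X) :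
    wordAct P k r (fun i => permute P (s i) (t i)) = wordAct P k r t := by
  have h : (wordAct P k r).compLinearMap (fun i => permute P (X := X) (s i)) = wordAct P k r :=
    wordSum_multilinear_ext P fun m x p => by
      simp only [MultilinearMap.compLinearMap_apply, permute_word]
      rw [wordAct_word, wordAct_word, P.comp_relabel, mono_relabel, flatten_comp_blockSum]
      simp only [Function.comp_assoc, Equiv.symm_comp_self, Function.comp_id]
  exact congrArg (fun F : MultilinearMap K _ (FreeCarrier P X) => F t) h

theorem wordAct_update_symRel {k : ℕ} (r : P.obj k) (t : Fin k → WordSum P X) (i : Fin k)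
    {y : WordSum P X} (hy : y ∈ symRel P X) :
    wordAct P k r (Function.update t i y) = 0 := by
  refine (Submodule.span_le (p := LinearMap.ker ((wordAct P k r).toLinearMap t i))).2 ?_ hy
  rintro _ ⟨s, y, rfl⟩
  rw [SetLike.mem_coe, LinearMap.mem_ker, map_sub, sub_eq_zero, MultilinearMap.toLinearMap_apply,
    MultilinearMap.toLinearMap_apply,
    ← wordAct_permute P r (Function.update (fun _ _ => Equiv.refl _) i s) (Function.update t i y)]
  congr 1
  funext j
  by_cases h : j = i
  · subst h
    simp
  · simp [h, permute_refl]

/-- The action of an operation on words is well defined on the free algebra: representatives can be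
exchanged one argument at a time. -/
theorem wordAct_congr {k : ℕ} (r : P.obj k) {t t' : Fin k → WordSum P X}
    (h : ∀ i, (symRel P X).mkQ (t i) = (symRel P X).mkQ (t' i)) :
    wordAct P k r t = wordAct P k r t' := by
  have key : ∀ S : Finset (Fin k), wordAct P k r (S.piecewise t t') = wordAct P k r t' := by
    intro S
    induction S using Finset.induction_on with
    | empty => simp
    | insert i S hi ih =>
      rw [← ih, Finset.piecewise_insert, ← sub_eq_zero]
      have hS : S.piecewise t t' = Function.update (S.piecewise t t') i (t' i) := by
        rw [← Finset.piecewise_eq_of_notMem S t t' hi, Function.update_eq_self]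
      conv_lhs => rw [hS]
      rw [Function.update_idem, ← MultilinearMap.map_update_sub]
      exact wordAct_update_symRel P r _ i ((Submodule.Quotient.eq _).1 (h i))
  simpa using key Finset.univ

variable (X) in
theorem exists_linear_section :
    ∃ s : FreeCarrier P X →ₗ[K] WordSum P X, (symRel P X).mkQ ∘ₗ s = LinearMap.id :=
  (symRel P X).mkQ.exists_rightInverse_of_surjective (symRel P X).range_mkQ

/-- The action of operations on the free algebra.  It is computed on arbitrary representatives,
chosen by a linear section of the quotient map. -/
def freeAct (k : ℕ) :
    P.obj k →ₗ[K] (⨂[K] _i : Fin k, FreeCarrier P X) →ₗ[K] FreeCarrier P X :=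
  (PiTensorProduct.lift (s := fun _ : Fin k => FreeCarrier P X)).toLinearMap ∘ₗ
    MultilinearMap.compLinearMapₗ (fun _ => (exists_linear_section P X).choose) ∘ₗ wordAct P k

theorem freeAct_mono {k : ℕ} (r : P.obj k) {m : Fin k → ℕ} (x : ∀ i, Fin (m i) → X)
    (p : ∀ i, P.obj (m i)) :
    freeAct P k r (tprod K fun i => mono P (x i) (p i)) =
      mono P (flatten x) (P.comp m r p) := by
  rw [← wordAct_word]
  simp only [freeAct, LinearMap.comp_apply, LinearEquiv.coe_coe, PiTensorProduct.lift.tprod]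
  exact wordAct_congr P r fun i =>
    LinearMap.congr_fun (exists_linear_section P X).choose_spec (mono P (x i) (p i))

theorem freeAct_relabel {m n : ℕ} (σ : Fin m ≃ Fin n) (r : P.obj m)
    (y : Fin n → FreeCarrier P X) :
    freeAct P n (P.relabel σ r) (tprod K y) = freeAct P m r (tprod K fun i => y (σ i)) := by
  rw [← opRelabel_tprod]
  refine congrArg (fun F : MultilinearMap K _ _ => F y) (freeCarrier_multilinear_ext P
    (f := (freeAct P n (P.relabel σ r)).compMultilinearMap (tprod K))
    (g := (opRelabel σ (freeAct P m r)).compMultilinearMap (tprod K)) fun l x p => ?_)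
  simp only [LinearMap.compMultilinearMap_apply, opRelabel_tprod]
  rw [freeAct_mono, freeAct_mono, P.relabel_comp, mono_relabel]
  refine congrArg (fun z => mono P z _) (funext fun a => ?_)
  simp only [flatten, blockPerm, Function.comp_apply, Equiv.trans_apply]
  rw [Equiv.symm_apply_apply]
  rfl

theorem freeAct_one (y : Fin 1 → FreeCarrier P X) : freeAct P 1 P.one (tprod K y) = y 0 := by
  rw [← PiTensorProduct.subsingletonEquiv_apply_tprod (R := K) (0 : Fin 1) y]
  refine congrArg (fun F : MultilinearMap K _ _ => F y) (freeCarrier_multilinear_ext P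
    (f := (freeAct P 1 P.one).compMultilinearMap (tprod K))
    (g := (PiTensorProduct.subsingletonEquiv (0 : Fin 1)).toLinearMap.compMultilinearMap
      (tprod K)) fun l x p => ?_)
  simp only [LinearMap.compMultilinearMap_apply, LinearEquiv.coe_coe,
    PiTensorProduct.subsingletonEquiv_apply_tprod]
  rw [freeAct_mono]
  obtain ⟨n, rfl⟩ : ∃ n, l = fun _ => n := ⟨l 0, funext fun i => by rw [Subsingleton.elim i 0]⟩
  obtain ⟨p, rfl⟩ : ∃ p', p = fun _ => p' := ⟨p 0, funext fun i => by rw [Subsingleton.elim i 0]⟩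
  rw [P.one_comp, mono_relabel]
  refine congrArg (fun z => mono P z _) (funext fun a => ?_)
  simp only [flatten, sumOne, Function.comp_apply, Equiv.trans_apply]
  rw [Equiv.symm_apply_apply]
  rfl

theorem flatten_flatten_comp_sumAssoc {k : ℕ} {n : Fin k → ℕ} (m : ∀ i, Fin (n i) → ℕ)
    (x : ∀ i j, Fin (m i j) → X) :
    flatten (n := flatten m)
        (fun a => x (finSigmaFinEquiv.symm a).1 (finSigmaFinEquiv.symm a).2) ∘ sumAssoc m =
      flatten fun i => flatten (x i) := by
  funext b
  obtain ⟨⟨a, l⟩, hb⟩ := finSigmaFinEquiv.surjective (sumAssoc m b)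
  obtain rfl := (sumAssoc m).injective ((sumAssoc_apply m a l).trans hb)
  rw [Function.comp_apply, sumAssoc_apply, flatten_finSigmaFinEquiv]
  exact (flatten_finSigmaFinEquiv (n := flatten m) _ a l).trans
    (flatten_finSigmaFinEquiv (x (finSigmaFinEquiv.symm a).1) _ l).symm

/-- A family indexed by `Fin (∑ i, n i)` is a doubly indexed family. -/
theorem exists_eq_finSigmaFinEquiv_symm {k : ℕ} {n : Fin k → ℕ}
    {γ : (i : Fin k) × Fin (n i) → Type*} (f : ∀ a, γ (finSigmaFinEquiv.symm a)) :
    ∃ g : ∀ i j, γ ⟨i, j⟩,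
      f = fun a => g (finSigmaFinEquiv.symm a).1 (finSigmaFinEquiv.symm a).2 :=
  ⟨fun i j => Equiv.piCongrLeft γ finSigmaFinEquiv.symm f ⟨i, j⟩,
    funext fun a => (Equiv.piCongrLeft_apply_apply γ finSigmaFinEquiv.symm f a).symm⟩

theorem freeAct_comp {k : ℕ} (n : Fin k → ℕ) (r : P.obj k) (q : ∀ i, P.obj (n i))
    (y : Fin (∑ i, n i) → FreeCarrier P X) :
    freeAct P _ (P.comp n r q) (tprod K y) =
      freeAct P k r (tprod K fun i =>
        freeAct P (n i) (q i) (tprod K fun j => y (finSigmaFinEquiv ⟨i, j⟩))) := by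
  rw [← opComp_tprod]
  refine congrArg (fun F : MultilinearMap K _ _ => F y) (freeCarrier_multilinear_ext P
    (f := (freeAct P _ (P.comp n r q)).compMultilinearMap (tprod K))
    (g := (opComp (freeAct P k r) fun i => freeAct P (n i) (q i)).compMultilinearMap (tprod K))
    fun l x p => ?_)
  simp only [LinearMap.compMultilinearMap_apply, opComp_tprod]
  -- The arguments are indexed doubly, as in the associativity axiom of the operad.
  obtain ⟨m, rfl⟩ : ∃ m, l = flatten m :=
    ⟨fun i j => l (finSigmaFinEquiv ⟨i, j⟩), funext fun a => by simp [flatten]⟩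
  obtain ⟨x, rfl⟩ := exists_eq_finSigmaFinEquiv_symm (γ := fun s => Fin (m s.1 s.2) → X) x
  obtain ⟨p, rfl⟩ := exists_eq_finSigmaFinEquiv_symm (γ := fun s => P.obj (m s.1 s.2)) p
  refine (freeAct_mono P (P.comp n r q) (m := flatten m) _ _).trans ?_
  refine Eq.trans (congrArg _ (P.comp_assoc r q p).symm) ?_
  rw [mono_relabel, flatten_flatten_comp_sumAssoc, ← freeAct_mono]
  refine congrArg (fun z => freeAct P k r (tprod K z)) (funext fun i => ?_)
  rw [← freeAct_mono]
  refine congrArg (fun z => freeAct P (n i) (q i) (tprod K z)) (funext fun j => ?_)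
  -- The arity of `p i j` depends on the index, so the index is replaced in `p` and `x` at once.
  let G : ((i : Fin k) × Fin (n i)) → FreeCarrier P X := fun s => mono P (x s.1 s.2) (p s.1 s.2)
  exact (congrArg G (finSigmaFinEquiv.symm_apply_apply ⟨i, j⟩)).symm

variable (X) in
/-- The free `P`-algebra on the set `X`. -/
def freeAlg : Alg.{u, v, max u v} P where
  carrier := ModuleCat.of K (FreeCarrier P X)
  act := freeAct P
  act_relabel := freeAct_relabel P
  act_one := freeAct_one P
  act_comp := freeAct_comp P

/-- The generators of the free algebra. -/
def gen (i : X) : FreeCarrier P X := mono P (fun _ : Fin 1 => i) P.one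

theorem freeAct_gen {m : ℕ} (p : P.obj m) (x : Fin m → X) :
    freeAct P m p (tprod K fun j => gen P (x j)) = mono P x p := by
  simp only [gen]
  rw [freeAct_mono, P.comp_one, mono_relabel]
  refine congrArg (fun z => mono P z _) (funext fun a => ?_)
  simp only [flatten, sumOnes, Function.comp_apply, Equiv.trans_apply]
  rw [Equiv.symm_apply_apply]
  rfl

variable {P}

/-- The linear map underlying the morphism from the free algebra with given values on the
generators. -/
def freeLiftFun (A : Alg.{u, v, w} P) (a : X → A.carrier) : FreeCarrier P X →ₗ[K] A.carrier :=
  freeDesc P (fun _ x => (A.act _).flip (tprod K (a ∘ x))) fun _ σ x p => A.act_relabel σ p (a ∘ x)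

theorem freeLiftFun_mono (A : Alg.{u, v, w} P) (a : X → A.carrier) {m : ℕ} (x : Fin m → X)
    (p : P.obj m) : freeLiftFun A a (mono P x p) = A.act m p (tprod K (a ∘ x)) :=
  freeDesc_mono P _ _ x p

theorem freeLiftFun_gen (A : Alg.{u, v, w} P) (a : X → A.carrier) (i : X) :
    freeLiftFun A a (gen P i) = a i := by
  rw [gen, freeLiftFun_mono, A.act_one]
  rfl

/-- The morphism from the free algebra with given values on the generators. -/
def freeLift (A : Alg.{u, v, max u v} P) (a : X → A.carrier) : freeAlg P X ⟶ A where
  hom := ModuleCat.ofHom (freeLiftFun A a)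
  hom_act n r t := by
    refine LinearMap.congr_fun (f := freeLiftFun A a ∘ₗ freeAct P n r)
      (g := A.act n r ∘ₗ PiTensorProduct.map fun _ => freeLiftFun A a)
      (PiTensorProduct.ext (freeCarrier_multilinear_ext P fun m x p => ?_)) t
    simp only [LinearMap.compMultilinearMap_apply, LinearMap.comp_apply,
      PiTensorProduct.map_tprod]
    rw [freeAct_mono, freeLiftFun_mono, A.act_comp]
    simp only [freeLiftFun_mono]
    refine congrArg (fun z => A.act n r (tprod K z)) (funext fun i => ?_)
    refine congrArg (fun z => A.act (m i) (p i) (tprod K z)) (funext fun j => ?_)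
    exact congrArg a (flatten_finSigmaFinEquiv x i j)

/-! ### The multilinear part of the free algebra -/

variable (P)

/-- The endomorphism of the free algebra that multiplies each generator `x_i` by `c i`. -/
def rescale (c : X → K) : FreeCarrier P X →ₗ[K] FreeCarrier P X :=
  freeDesc P (fun _ x => (∏ j, c (x j)) • mono P x) fun m σ x p => by
    simp only [LinearMap.smul_apply, mono_relabel, Function.comp_apply]
    rw [Equiv.prod_comp σ fun j => c (x j)]

theorem rescale_mono (c : X → K) {m : ℕ} (x : Fin m → X) (p : P.obj m) :
    rescale P c (mono P x p) = (∏ j, c (x j)) • mono P x p :=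
  freeDesc_mono P _ _ x p

theorem freeLiftFun_smul_gen (c : X → K) :
    freeLiftFun (freeAlg P X) (fun i => c i • gen P i) = rescale P c := by
  refine freeCarrier_hom_ext P fun m x p => ?_
  have h : freeAct P m p (tprod K fun j => c (x j) • gen P (x j)) =
      rescale P c (mono P x p) := by
    rw [rescale_mono, ← freeAct_gen, ← map_smul]
    exact congrArg (freeAct P m p)
      ((PiTensorProduct.tprod K).map_smul_univ (fun j => c (x j)) (fun j => gen P (x j)))
  exact (freeLiftFun_mono (freeAlg P X) _ x p).trans h

/-- The coefficient of `x₁ ⋯ x_n` in the free algebra on `n` generators: words that are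
permutations of the generators yield a permuted operation, all other words yield `0`.  The
generators are lifted to the universe of `K`, as are the alphabets of all free algebras here, so
that the free algebra lies in the universe of the algebras on which `unit` is considered. -/
def multilinearPart (n : ℕ) : FreeCarrier P (ULift.{u} (Fin n)) →ₗ[K] P.obj n :=
  open Classical in
  freeDesc P
    (fun _ x => if h : Function.Bijective (ULift.down ∘ x) then
      P.relabel (Equiv.ofBijective _ h) else 0)
    fun m σ x p => by
      have hσ : Function.Bijective (ULift.down ∘ x ∘ σ) ↔ Function.Bijective (ULift.down ∘ x) :=
        Function.Bijective.of_comp_iff (ULift.down ∘ x) σ.bijective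
      by_cases h : Function.Bijective (ULift.down ∘ x)
      · rw [dif_pos h, dif_pos (hσ.2 h), ← P.relabel_trans]
        exact congrArg (fun τ => P.relabel τ p) (Equiv.ext fun _ => rfl)
      · rw [dif_neg h, dif_neg (mt hσ.1 h)]
        rfl

theorem multilinearPart_mono_of_bijective {n m : ℕ} {x : Fin m → ULift.{u} (Fin n)}
    (h : Function.Bijective (ULift.down ∘ x)) (p : P.obj m) :
    multilinearPart P n (mono P x p) = P.relabel (Equiv.ofBijective _ h) p := by
  rw [multilinearPart, freeDesc_mono, dif_pos h]

theorem multilinearPart_mono_of_not_bijective {n m : ℕ} {x : Fin m → ULift.{u} (Fin n)}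
    (h : ¬ Function.Bijective (ULift.down ∘ x)) (p : P.obj m) :
    multilinearPart P n (mono P x p) = 0 := by
  rw [multilinearPart, freeDesc_mono, dif_neg h]
  rfl

theorem multilinearPart_mono_up {n : ℕ} (p : P.obj n) :
    multilinearPart P n (mono P ULift.up p) = p := by
  rw [multilinearPart_mono_of_bijective P Function.bijective_id]
  refine Eq.trans (b := P.relabel (Equiv.refl _) p) ?_ (P.relabel_refl p)
  exact congrArg (fun τ => P.relabel τ p) (Equiv.ext fun _ => rfl)

theorem mono_up_multilinearPart_mono {n m : ℕ} {x : Fin m → ULift.{u} (Fin n)}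
    (h : Function.Bijective (ULift.down ∘ x)) (p : P.obj m) :
    mono P ULift.up (multilinearPart P n (mono P x p)) = mono P x p := by
  rw [multilinearPart_mono_of_bijective P h, mono_relabel]
  rfl

theorem prod_X_eq_monomial {n m : ℕ} (x : Fin m → Fin n) :
    ∏ j, (MvPolynomial.X (x j) : MvPolynomial (Fin n) K) =
      MvPolynomial.monomial (∑ j, Finsupp.single (x j) 1) 1 := by
  simp [MvPolynomial.X, MvPolynomial.monomial_sum_one]

/-- The monomial of a word is the product of all variables exactly when each letter occurs once in
the word. -/
theorem sum_single_eq_one_iff {n m : ℕ} (x : Fin m → Fin n) :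
    ∑ j, Finsupp.single (x j) 1 = (∑ j, Finsupp.single j 1 : Fin n →₀ ℕ) ↔
      Function.Bijective x := by
  constructor
  · intro h
    rw [Function.bijective_iff_existsUnique]
    intro i
    have hi := DFunLike.congr_fun h i
    simp only [Finsupp.finsetSum_apply, Finsupp.single_apply, Finset.sum_boole,
      Finset.filter_eq', Finset.mem_univ, if_true, Finset.card_singleton] at hi
    obtain ⟨j, hj⟩ := Finset.card_eq_one.1 (Nat.cast_injective hi)
    exact ⟨j, by simpa using hj.ge (Finset.mem_singleton_self j),
      fun k hk => Finset.mem_singleton.1 (hj.le (by simpa using hk))⟩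
  · intro h
    exact h.sum_comp fun j => Finsupp.single j 1

/-- Over an infinite field, an element of the free algebra on `x₁, …, x_n` that is multiplied by
`∏ i, c i` whenever each generator `x_i` is multiplied by `c i` has the form `p(x₁, …, x_n)`. -/
theorem eq_mono_multilinearPart [Infinite K] {n : ℕ} (t : FreeCarrier P (ULift.{u} (Fin n)))
    (ht : ∀ c : Fin n → K, rescale P (fun i => c i.down) t = (∏ i, c i) • t) :
    mono P ULift.up (multilinearPart P n t) = t := by
  rw [← sub_eq_zero, ← Module.forall_dual_apply_eq_zero_iff K]
  intro f
  rw [map_sub, sub_eq_zero]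
  obtain ⟨t, rfl⟩ := (symRel P _).mkQ_surjective t
  -- The polynomial in the scalars `c` whose values are `f` of the rescaled element.
  let g : WordSum P (ULift.{u} (Fin n)) →ₗ[K] MvPolynomial (Fin n) K :=
    wordDesc P fun _ x => (f ∘ₗ mono P x).smulRight (∏ j, MvPolynomial.X (x j).down)
  have hg : ∀ {m : ℕ} (x : Fin m → ULift.{u} (Fin n)) (p : P.obj m),
      g (word P x p) = f (mono P x p) • ∏ j, MvPolynomial.X (x j).down := fun x p =>
    wordDesc_word P _ x p
  have heval : ∀ c : Fin n → K, MvPolynomial.eval c (g t) =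
      f (rescale P (fun i => c i.down) ((symRel P _).mkQ t)) := by
    intro c
    refine LinearMap.congr_fun (f := (MvPolynomial.aeval c).toLinearMap ∘ₗ g)
      (g := f ∘ₗ rescale P (fun i => c i.down) ∘ₗ (symRel P _).mkQ)
      (wordSum_hom_ext P fun m x p => ?_) t
    simp only [LinearMap.comp_apply, mkQ_word, hg]
    rw [rescale_mono]
    simp [mul_comm]
  have hgt : g t = f ((symRel P _).mkQ t) • ∏ j, MvPolynomial.X j := by
    refine MvPolynomial.funext fun c => ?_
    rw [heval, ht]
    simp [mul_comm]
  -- Only the words in which each letter occurs once contribute to this coefficient.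
  have hcoeff : MvPolynomial.coeff (∑ j, Finsupp.single j 1) (g t) =
      f (mono P ULift.up (multilinearPart P n ((symRel P _).mkQ t))) := by
    refine LinearMap.congr_fun (f := MvPolynomial.lcoeff K _ ∘ₗ g)
      (g := f ∘ₗ mono P ULift.up ∘ₗ multilinearPart P n ∘ₗ (symRel P _).mkQ)
      (wordSum_hom_ext P fun m x p => ?_) t
    simp only [LinearMap.comp_apply, mkQ_word, hg, map_smul, MvPolynomial.lcoeff_apply]
    rw [prod_X_eq_monomial fun j => (x j).down, MvPolynomial.coeff_monomial]
    have hx := sum_single_eq_one_iff fun j => (x j).down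
    by_cases h : Function.Bijective (ULift.down ∘ x)
    · rw [mono_up_multilinearPart_mono P h, if_pos (hx.2 h), smul_eq_mul, mul_one]
    · rw [multilinearPart_mono_of_not_bijective P h, if_neg (mt hx.1 h), smul_zero,
        map_zero, map_zero]
  rw [← hcoeff, hgt, prod_X_eq_monomial fun j => j, MvPolynomial.coeff_smul,
    MvPolynomial.coeff_monomial, if_pos rfl, smul_eq_mul, mul_one]

/-! ### Natural operations are evaluated on the generators -/

/-- An operation `p` is recovered from its value `p(x₁, …, x_n)` on the generators of the free
algebra. -/
theorem unit_app_injective (n : ℕ) :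
    Function.Injective ((unit.{u, v, max u v} P).app n) := by
  intro p q h
  have h' : freeAct P n p (tprod K fun j => gen P (ULift.up.{u} j)) =
      freeAct P n q (tprod K fun j => gen P (ULift.up.{u} j)) :=
    congrArg (fun φ : natTrans (Alg.forget.{u, v, max u v} P) n =>
      φ.1 (freeAlg P (ULift.{u} (Fin n))) (tprod K fun j => gen P (ULift.up j))) h
  rw [freeAct_gen, freeAct_gen] at h'
  rw [← multilinearPart_mono_up P p, h', multilinearPart_mono_up]

/-- A natural operation is the action of the multilinear part of its value on the generators of the
free algebra. -/
theorem unit_app_surjective [Infinite K] (n : ℕ) :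
    Function.Surjective ((unit.{u, v, max u v} P).app n) := by
  intro (φ : natTrans (Alg.forget.{u, v, max u v} P) n)
  let t : FreeCarrier P (ULift.{u} (Fin n)) :=
    φ.1 (freeAlg P (ULift.{u} (Fin n))) (tprod K fun j => gen P (ULift.up j))
  -- By naturality, `φ` is determined by its value `t` on the generators.
  have hφ : ∀ (A : Alg.{u, v, max u v} P) (a : Fin n → A.carrier),
      φ.1 A (tprod K a) = freeLiftFun A (fun i : ULift.{u} (Fin n) => a i.down) t := by
    intro A a
    have h := natTrans_tprod φ (freeLift A fun i : ULift.{u} (Fin n) => a i.down)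
      fun j => gen P (ULift.up j)
    refine Eq.trans (congrArg (fun z => φ.1 A (tprod K z)) (funext fun j => ?_)) h
    exact (freeLiftFun_gen A (fun i : ULift.{u} (Fin n) => a i.down) (ULift.up j)).symm
  have ht : mono P ULift.up (multilinearPart P n t) = t := by
    refine eq_mono_multilinearPart P t fun c => ?_
    rw [← freeLiftFun_smul_gen]
    refine (hφ (freeAlg P (ULift.{u} (Fin n))) fun j => c j • gen P (ULift.up j)).symm.trans ?_
    refine (congrArg (φ.1 (freeAlg P (ULift.{u} (Fin n))))
      ((PiTensorProduct.tprod K).map_smul_univ c fun j => gen P (ULift.up j))).trans ?_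
    exact map_smul _ _ _
  refine ⟨multilinearPart P n t, natTrans_ext fun A a => ?_⟩
  refine Eq.trans ?_ (hφ A a).symm
  refine Eq.trans ?_ (congrArg (freeLiftFun A fun i : ULift.{u} (Fin n) => a i.down) ht)
  exact (freeLiftFun_mono A (fun i : ULift.{u} (Fin n) => a i.down) ULift.up
    (multilinearPart P n t)).symm

end LinOperad

end

theorem mainTheorem1 {K : Type u} [Field K] [Infinite K] (P : LinOperad.{u, v} K) :
    (LinOperad.unit.{u, v, max u v} P).IsIso :=
  LinOperad.Hom.isIso_of_bijective _ fun n =>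
    ⟨LinOperad.unit_app_injective P n, LinOperad.unit_app_surjective P n⟩
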